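/- Let $P(\lambda)=A_0+A_1\lambda+\dots+A_d\lambda^d$ with $A_i\in\mathbb{C}^{n\times n}$, $A_d\neq 0$ and $\det A_0\neq 0$. Let $\zeta_1,\dots,\zeta_N$ be the finite eigenvalues of $P$, i.e. the roots of $\det P(\lambda)$ counted with multiplicity, arranged by non-decreasing modulus (so $N\le nd$, with equality iff $\det A_d\ne 0$; if $N<nd$ the other $nd-N$ eigenvalues are infinite and come last). Let $\|\cdot\|$ be a norm on $\mathbb{C}^{n\times n}$ for which there are $Q,Q'\in\mathbb{C}^{n\times n}$ with $\det Q=\det Q'=1$ and $\|QAQ'\|_{\mathrm{nF}}\le\|A\|$ for all $A\in\mathbb{C}^{n\times n}$, where $\|A\|_{\mathrm{nF}}=\bigl(\frac1n\sum_{i,j}|A_{ij}|^2\bigr)^{1/2}$ (Assumption A2). For $i=1,\dots,n$ let $\eta_i$ be the least positive constant such that the Euclidean norm of the $i$-th column of $A$ is at most $\eta_i\|A\|$ for all $A\in\mathbb{C}^{n\times n}$, and let $\eta=\eta_1\cdots\eta_n$. Let $C_{n,d,m}$ be the number of maps $\phi:\{1,\dots,n\}\to\{0,\dots,d\}$ with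 $\sum_{i}\phi(i)=m$. Let $\alpha_1\le\dots\le\alpha_d$ be the tropical roots of $\max_{0\le i\le d}\|A_i\|x^i$, i.e. the nonnegative numbers such that $\max_{0\le i\le d}\|A_i\|x^i=\|A_d\|\prod_{l=1}^d\max(x,\alpha_l)$ for all $x\ge 0$. Let $0=k_0<k_1<\dots<k_q=d$ be the abscissae of all the vertices of the Newton polygon, i.e. of the upper boundary of the convex hull of $\{(i,y)\in\mathbb{N}\times\mathbb{R} : 0\le i\le d,\ y\le\log\|A_i\|\}$. For $0\le j\le q$ put $\delta_j=\alpha_{k_j}/\alpha_{k_j+1}$, with $\alpha_0=0$ and $\alpha_{d+1}=+\infty$ (so $\delta_0=\delta_q=0$), and $$c_j=\frac{|\det A_{k_j}|}{\|A_{k_j}\|^n}-(C_{n,d,nk_j}-1)\,\eta\,\delta_j .$$ Then for every $1\le j\le q$ such that $c_j>0$ and $c_{j-1}>0$, we have $nk_j\le N$ and $$\frac{c_{j-1}}{\binom{nd}{nk_{j-1}}}\left(\frac{1-\delta_j}{1+\delta_j}\right)^{n/2}\le\frac{|\zeta_{nk_{j-1}+1}\cdots\zeta_{nk_j}|}{(\alpha_{k_j})^{n(k_j-k_{j-1})}}\le\frac{\binom{nd}{nk_j}}{c_j}\left(\frac{1+\delta_{j-1}}{1-\delta_{j-1}}\right)^{n/2}.$$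 -/

import Mathlib

noncomputable section

namespace TropEig

/-- The max-times polynomial `x ↦ max_{0 ≤ j ≤ d} a_j x^j`. -/
def tropEval (d : ℕ) (a : ℕ → ℝ) (x : ℝ) : ℝ :=
  (Finset.range (d + 1)).sup' Finset.nonempty_range_add_one (fun j => a j * x ^ j)

/-- `α 1 ≤ ⋯ ≤ α d` are the tropical roots, counted with multiplicity, of the max-times polynomial
`max_{0 ≤ j ≤ d} a_j x^j` (where `a d ≠ 0`): they are the nonnegative numbers with
`max_j a_j x^j = a_d ∏_{l=1}^d max (x, α l)` for all `x ≥ 0`.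
The values of `α` outside `{1, …, d}` play no role. -/
structure IsTropicalRoots (d : ℕ) (a : ℕ → ℝ) (α : ℕ → ℝ) : Prop where
  nonneg : ∀ l ∈ Set.Icc 1 d, 0 ≤ α l
  mono : MonotoneOn α (Set.Icc 1 d)
  factor : ∀ x : ℝ, 0 ≤ x → tropEval d a x = a d * ∏ l ∈ Finset.Icc 1 d, max x (α l)

/-- The set of the points `(j, y)` with `0 ≤ j ≤ d` and `y ≤ log a_j` (no point lies above `j` when
`a_j = 0`, since then `log a_j = -∞`). The Newton polygon is the upper boundary of its convex
hull. -/
def newtonRegion (d : ℕ) (a : ℕ → ℝ) : Set (ℝ × ℝ) :=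
  {p | ∃ j ≤ d, 0 < a j ∧ p.1 = (j : ℝ) ∧ p.2 ≤ Real.log (a j)}

/-- The abscissae of the vertices of the Newton polygon. -/
def newtonVertices (d : ℕ) (a : ℕ → ℝ) : Set ℕ :=
  {k | ∃ y : ℝ, ((k : ℝ), y) ∈ (convexHull ℝ (newtonRegion d a)).extremePoints ℝ}

/-- The separation ratio `α k / α (k + 1)`, with the conventions `α 0 = 0` and
`α (d + 1) = +∞`. -/
def separation (d : ℕ) (α : ℕ → ℝ) (k : ℕ) : ℝ :=
  if k = 0 ∨ k = d then 0 else α k / α (k + 1)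

/-- The polynomial `det (A_0 + A_1 X + ⋯ + A_d X^d)`. -/
def detPoly {n : ℕ} (d : ℕ) (A : ℕ → Matrix (Fin n) (Fin n) ℂ) : Polynomial ℂ :=
  (∑ j ∈ Finset.range (d + 1),
    (Polynomial.X ^ j : Polynomial ℂ) • (A j).map (Polynomial.C : ℂ → Polynomial ℂ)).det

/-- `ζ 1, …, ζ N` are the (finite) eigenvalues of the matrix polynomial
`A_0 + A_1 X + ⋯ + A_d X^d`, counted with multiplicity and arranged by non-decreasing modulus.
When `N < n * d`, the remaining `n * d - N` eigenvalues are infinite, and come last in this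
arrangement. The values of `ζ` outside `{1, …, N}` play no role. -/
structure IsEigenvalueSeq {n : ℕ} (d : ℕ) (A : ℕ → Matrix (Fin n) (Fin n) ℂ)
    (N : ℕ) (ζ : ℕ → ℂ) : Prop where
  roots : (Finset.Icc 1 N).val.map ζ = (detPoly d A).roots
  mono : MonotoneOn (fun i => ‖ζ i‖) (Set.Icc 1 N)

/-- The normalized Frobenius norm. -/
def normFrob {n : ℕ} (A : Matrix (Fin n) (Fin n) ℂ) : ℝ :=
  Real.sqrt ((1 / (n : ℝ)) * ∑ i, ∑ j, ‖A i j‖ ^ 2)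

/-- There are `Q, Q'` of determinant one such that `‖Q A Q'‖_nF ≤ ‖A‖` for all `A`. -/
def DominatesFrob {n : ℕ} (ν : Seminorm ℂ (Matrix (Fin n) (Fin n) ℂ)) : Prop :=
  ∃ Q Q' : Matrix (Fin n) (Fin n) ℂ, Q.det = 1 ∧ Q'.det = 1 ∧
    ∀ A : Matrix (Fin n) (Fin n) ℂ, normFrob (Q * A * Q') ≤ ν A

/-- The least positive constant `t` such that the Euclidean norm of the `i`-th column of `A` is at
most `t * ‖A‖`, for all `A`. -/
def colConst {n : ℕ} (ν : Seminorm ℂ (Matrix (Fin n) (Fin n) ℂ)) (i : Fin n) : ℝ :=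
  sInf {t : ℝ | 0 < t ∧ ∀ A : Matrix (Fin n) (Fin n) ℂ,
    ‖(WithLp.toLp 2 (fun l => A l i) : EuclideanSpace ℂ (Fin n))‖ ≤ t * ν A}

/-- The number of maps `φ : {1, …, n} → {0, …, d}` of sum `m`. -/
def numMaps (n d m : ℕ) : ℕ :=
  (Finset.univ.filter (fun φ : Fin n → Fin (d + 1) => ∑ i, (φ i : ℕ) = m)).card

/-- `|det A_k| / ‖A_k‖^n - (C_{n,d,nk} - 1) η δ`, where `δ` is the separation ratio at `k` and `η`
is the product of the column constants. -/
def vertexConst {n : ℕ} (d : ℕ) (ν : Seminorm ℂ (Matrix (Fin n) (Fin n) ℂ))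
    (A : ℕ → Matrix (Fin n) (Fin n) ℂ) (α : ℕ → ℝ) (k : ℕ) : ℝ :=
  ‖(A k).det‖ / ν (A k) ^ n
    - ((numMaps n d (n * k) : ℝ) - 1) * (∏ i, colConst ν i) * separation d α k

end TropEig

end

/-! Let p = det P have leading coefficient ℓ, and put L(m) = |ℓ| ∏_{i>m} |ζ_i|. At a vertex k of the
Newton polygon, with separation δ and constant c, L(nk) is compared with ‖A_k‖^n from both sides: c
‖A_k‖^n ≤ binom(nd, nk) L(nk) and L(nk) ≤ ‖A_k‖^n ((1+δ)/(1-δ))^{n/2}.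

Lower bound (`le_norm_leadingCoeff_mul_prod`). Expanding det P by columns, the coefficient of λ^{nk}
is det A_k plus C_{n,d,nk} - 1 mixed determinants. Hadamard's inequality and the decay of ‖A_i‖ away
from a vertex bound each of them by η δ ‖A_k‖^n. A coefficient of p is at most a binomial
coefficient times L.

Upper bound (`norm_leadingCoeff_mul_prod_le`). By Jensen's formula, r^{nk} L(nk) is at most the
exponential of the mean of log |p| on |z| = r. Hadamard's inequality, concavity of log and Parseval
bound this by (∑ ‖A_j‖² r^{2j})^{n/2}. For r² = α_k α_{k+1} the sum is dominated by two geometric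
series of ratio δ around j = k.

The product of the ζ_i in question is L(nk_{j-1}) / L(nk_j), and ‖A_{k_{j-1}}‖ / ‖A_{k_j}‖ is a
power of α_{k_j}; opposite bounds at the two vertices give the result. -/

namespace TropEig

/-! ### Tropical roots and vertices of the Newton polygon. -/

section Tropical

variable {d : ℕ} {a α : ℕ → ℝ}

theorem prod_max_eq {i : ℕ} (hi : i ≤ d) {x : ℝ} (h1 : ∀ l ∈ Finset.Ioc 0 i, α l ≤ x)
    (h2 : ∀ l ∈ Finset.Ioc i d, x ≤ α l) :
    ∏ l ∈ Finset.Icc 1 d, max x (α l) = x ^ i * ∏ l ∈ Finset.Ioc i d, α l := by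
  have : Finset.Icc 1 d = Finset.Ioc 0 d := rfl
  rw [this, ← Finset.prod_Ioc_consecutive _ (Nat.zero_le i) hi]
  congr 1
  · rw [Finset.prod_congr rfl fun l hl => max_eq_left (h1 l hl)]
    simp
  · exact Finset.prod_congr rfl fun l hl => max_eq_right (h2 l hl)

theorem le_tropEval {i : ℕ} (hi : i ≤ d) (x : ℝ) : a i * x ^ i ≤ tropEval d a x :=
  Finset.le_sup' (fun j => a j * x ^ j) (Finset.mem_range.2 (Nat.lt_succ_of_le hi))

theorem exists_eq_tropEval (d : ℕ) (a : ℕ → ℝ) (x : ℝ) :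
    ∃ i ≤ d, tropEval d a x = a i * x ^ i := by
  obtain ⟨i, hi, h⟩ := Finset.exists_mem_eq_sup' Finset.nonempty_range_add_one
    (s := Finset.range (d + 1)) (fun j => a j * x ^ j)
  exact ⟨i, Nat.lt_succ_iff.1 (Finset.mem_range.1 hi), h⟩

namespace IsTropicalRoots

variable (hα : IsTropicalRoots d a α)

include hα

theorem le_of_le {l m : ℕ} (hl : 1 ≤ l) (hlm : l ≤ m) (hm : m ≤ d) : α l ≤ α m :=
  hα.mono ⟨hl, hlm.trans hm⟩ ⟨hl.trans hlm, hm⟩ hlm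

theorem coeff_zero_eq (h0 : 0 < a 0) : a 0 = a d * ∏ l ∈ Finset.Ioc 0 d, α l := by
  have h := hα.factor 0 le_rfl
  rw [prod_max_eq (i := 0) (Nat.zero_le d) (by simp)
    (fun l hl => hα.nonneg l (by simpa [Nat.succ_le_iff] using hl))] at h
  obtain ⟨i, -, hi⟩ := exists_eq_tropEval d a 0
  have h1 := le_tropEval (a := a) (Nat.zero_le d) 0
  rcases Nat.eq_zero_or_pos i with rfl | hpos
  · simpa using hi.symm.trans h
  · rw [hi, zero_pow hpos.ne'] at h1
    simp at h1
    linarith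

theorem root_pos (h0 : 0 < a 0) {l : ℕ} (hl : 1 ≤ l) (hld : l ≤ d) : 0 < α l := by
  refine lt_of_le_of_ne (hα.nonneg l ⟨hl, hld⟩) fun h => ?_
  have := hα.coeff_zero_eq h0
  rw [Finset.prod_eq_zero (i := l) (Finset.mem_Ioc.2 ⟨hl, hld⟩) h.symm] at this
  linarith

/-- At `x = α i` the tropical product collapses to `x ^ i` times the tail, and the `i`-th monomial
cannot exceed it. The right-hand side is the exponential of the height of the Newton polygon at `i`.
-/
theorem coeff_le (h0 : 0 < a 0) {i : ℕ} (hi : i ≤ d) :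
    a i ≤ a d * ∏ l ∈ Finset.Ioc i d, α l := by
  rcases Nat.eq_zero_or_pos i with rfl | hpos
  · exact (hα.coeff_zero_eq h0).le
  have hx := hα.root_pos h0 hpos hi
  have h := (le_tropEval (a := a) hi (α i)).trans_eq (hα.factor (α i) hx.le)
  rw [prod_max_eq hi (fun l hl => hα.le_of_le (Finset.mem_Ioc.1 hl).1 (Finset.mem_Ioc.1 hl).2 hi)
    (fun l hl => hα.le_of_le hpos (Finset.mem_Ioc.1 hl).1.le (Finset.mem_Ioc.1 hl).2)] at h
  have hp : 0 < α i ^ i := pow_pos hx i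
  refine le_of_mul_le_mul_right ?_ hp
  linarith

theorem tail_pos (h0 : 0 < a 0) (i : ℕ) : 0 < ∏ l ∈ Finset.Ioc i d, α l :=
  Finset.prod_pos fun l hl => hα.root_pos h0 (by have := Finset.mem_Ioc.1 hl; omega)
    (Finset.mem_Ioc.1 hl).2

/-- Strictly between two consecutive tropical roots only one monomial is maximal. -/
theorem tail_mul_pow_lt (h0 : 0 < a 0) {k i : ℕ} (hi : i ≤ d) (hk : k ≤ d) {x : ℝ}
    (hx : 0 < x) (h1 : ∀ l ∈ Finset.Ioc 0 k, α l < x) (h2 : ∀ l ∈ Finset.Ioc k d, x < α l)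
    (hik : i ≠ k) :
    (∏ l ∈ Finset.Ioc i d, α l) * x ^ i < (∏ l ∈ Finset.Ioc k d, α l) * x ^ k := by
  rcases lt_or_gt_of_ne hik with h | h
  · rw [← Finset.prod_Ioc_consecutive α h.le hk]
    have h3 : ∏ l ∈ Finset.Ioc i k, α l < x ^ (k - i) := by
      have : x ^ (k - i) = ∏ l ∈ Finset.Ioc i k, x := by simp
      rw [this]
      refine Finset.prod_lt_prod_of_nonempty (fun l hl => ?_) (fun l hl => ?_) ?_
      · have := Finset.mem_Ioc.1 hl
        exact hα.root_pos h0 (by omega) (by omega)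
      · have := Finset.mem_Ioc.1 hl
        exact h1 l (Finset.mem_Ioc.2 (by omega))
      · exact Finset.nonempty_Ioc.2 h
    have h4 : x ^ k = x ^ (k - i) * x ^ i := by rw [← pow_add]; congr 1; omega
    rw [h4]
    have h5 := mul_lt_mul_of_pos_right h3 (mul_pos (hα.tail_pos h0 k) (pow_pos hx i))
    linarith
  · rw [← Finset.prod_Ioc_consecutive α h.le hi]
    have h3 : x ^ (i - k) < ∏ l ∈ Finset.Ioc k i, α l := by
      have : x ^ (i - k) = ∏ l ∈ Finset.Ioc k i, x := by simp
      rw [this]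
      refine Finset.prod_lt_prod_of_nonempty (fun l hl => hx) (fun l hl => ?_) ?_
      · have := Finset.mem_Ioc.1 hl
        exact h2 l (Finset.mem_Ioc.2 (by omega))
      · exact Finset.nonempty_Ioc.2 h
    have h4 : x ^ i = x ^ (i - k) * x ^ k := by rw [← pow_add]; congr 1; omega
    rw [h4]
    have h5 := mul_lt_mul_of_pos_right h3 (mul_pos (hα.tail_pos h0 i) (pow_pos hx k))
    linarith

/-- For `x` strictly between the two roots, `coeff_le` keeps every monomial other than the `k`-th
strictly below the maximum; the maximum is attained, hence at `k`. The number `x` is returned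
because its logarithm gives the supporting line that makes `k` a vertex. -/
theorem coeff_eq_and_lt_of_lt (h0 : 0 < a 0) (hd : 0 < a d) {k : ℕ} (hk1 : 1 ≤ k) (hkd : k < d)
    (hlt : α k < α (k + 1)) :
    a k = a d * ∏ l ∈ Finset.Ioc k d, α l ∧
      ∃ x, 0 < x ∧ ∀ i ≤ d, i ≠ k → a i * x ^ i < a k * x ^ k := by
  obtain ⟨x, hx1, hx2⟩ := exists_between hlt
  have hx : 0 < x := (hα.root_pos h0 hk1 hkd.le).trans hx1
  have h1 : ∀ l ∈ Finset.Ioc 0 k, α l < x := fun l hl =>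
    (hα.le_of_le (Finset.mem_Ioc.1 hl).1 (Finset.mem_Ioc.1 hl).2 hkd.le).trans_lt hx1
  have h2 : ∀ l ∈ Finset.Ioc k d, x < α l := fun l hl =>
    hx2.trans_le (hα.le_of_le (by omega) (Finset.mem_Ioc.1 hl).1 (Finset.mem_Ioc.1 hl).2)
  have hlt' : ∀ i ≤ d, i ≠ k →
      a i * x ^ i < a d * (x ^ k * ∏ l ∈ Finset.Ioc k d, α l) := fun i hi hik => by
    have := mul_lt_mul_of_pos_left (hα.tail_mul_pow_lt h0 hi hkd.le hx h1 h2 hik) hd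
    have h5 := mul_le_mul_of_nonneg_right (hα.coeff_le h0 hi) (pow_pos hx i).le
    linarith
  have h3 := hα.factor x hx.le
  rw [prod_max_eq hkd.le (fun l hl => (h1 l hl).le) (fun l hl => (h2 l hl).le)] at h3
  obtain ⟨i, hi, h4⟩ := exists_eq_tropEval d a x
  have hik : i = k := by
    by_contra hik
    exact (hlt' i hi hik).ne (h4.symm.trans h3)
  subst hik
  have h5 : a i * x ^ i = a d * (x ^ i * ∏ l ∈ Finset.Ioc i d, α l) := h4.symm.trans h3
  refine ⟨?_, x, hx, fun m hm hmk => h5 ▸ hlt' m hm hmk⟩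
  refine mul_right_cancel₀ (pow_pos hx i).ne' ?_
  linarith

end IsTropicalRoots

/-- A point of the region which is the unique maximizer of an affine functional on it
is a vertex. -/
theorem mem_newtonVertices_of_lt {k : ℕ} (hk : k ≤ d) (hak : 0 < a k) {x : ℝ} (hx : 0 < x)
    (h : ∀ i ≤ d, i ≠ k → a i * x ^ i < a k * x ^ k) : k ∈ newtonVertices d a := by
  set f : ℝ × ℝ → ℝ := fun p => p.2 + p.1 * Real.log x with hf
  have hfl : ∀ (s t : ℝ) (p q : ℝ × ℝ), f (s • p + t • q) = s * f p + t * f q := by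
    intro s t p q
    simp [hf]; ring
  set v : ℝ × ℝ := ((k : ℝ), Real.log (a k)) with hv
  -- The functional `f` is the logarithm of a monomial at `x`. The set on the right is convex, so it
  -- is enough to check the generating points.
  have key : convexHull ℝ (newtonRegion d a) ⊆ {p | p = v ∨ f p < f v} := by
    refine convexHull_min ?_ ?_
    · rintro ⟨p1, p2⟩ ⟨i, hi, hai, hp1, hp2⟩
      simp only at hp1 hp2
      subst hp1
      by_cases hik : i = k
      · subst hik
        rcases hp2.eq_or_lt with rfl | hlt
        · exact Or.inl rfl
        · right
          simp only [hf, hv]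
          linarith
      · right
        have h1 := Real.log_lt_log (mul_pos hai (pow_pos hx i)) (h i hi hik)
        rw [Real.log_mul hai.ne' (pow_pos hx i).ne', Real.log_mul hak.ne' (pow_pos hx k).ne',
          Real.log_pow, Real.log_pow] at h1
        simp only [hf, hv]
        linarith
    · intro p hp q hq s t hs ht hst
      have hle : ∀ p, (p = v ∨ f p < f v) → f p ≤ f v := by
        rintro p (rfl | h)
        · exact le_rfl
        · exact h.le
      have hp' := hle p hp
      have hq' := hle q hq
      have e : s * f v + t * f v = f v := by rw [← add_mul, hst, one_mul]
      rcases hs.eq_or_lt with rfl | hs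
      · obtain rfl : t = 1 := by linarith
        simpa using hq
      rcases ht.eq_or_lt with rfl | ht
      · obtain rfl : s = 1 := by linarith
        simpa using hp
      rcases hp with rfl | hp
      · rcases hq with rfl | hq
        · left
          rw [← add_smul, hst, one_smul]
        · right
          rw [hfl]
          nlinarith
      · right
        rw [hfl]
        nlinarith
  have hmem : v ∈ convexHull ℝ (newtonRegion d a) :=
    subset_convexHull ℝ _ ⟨k, hk, hak, rfl, le_rfl⟩
  refine ⟨Real.log (a k), mem_extremePoints.2 ⟨hmem, ?_⟩⟩
  rintro p hp q hq ⟨s, t, hs, ht, hst, hpq⟩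
  have e : s * f p + t * f q = f v := by rw [← hfl, hpq]
  have e' : s * f v + t * f v = f v := by rw [← add_mul, hst, one_mul]
  rcases key hp with rfl | hp'
  · rcases key hq with rfl | hq'
    · exact ⟨rfl, rfl⟩
    · nlinarith
  · rcases key hq with rfl | hq'
    · nlinarith
    · nlinarith

theorem le_and_pos_of_mem_newtonVertices {k : ℕ} (hk : k ∈ newtonVertices d a) :
    k ≤ d ∧ 0 < a k ∧ ∃ y ≤ Real.log (a k),
      ((k : ℝ), y) ∈ (convexHull ℝ (newtonRegion d a)).extremePoints ℝ := by
  obtain ⟨y, hy⟩ := hk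
  obtain ⟨i, hi, hai, h1, h2⟩ := extremePoints_convexHull_subset hy
  obtain rfl : k = i := Nat.cast_injective h1
  exact ⟨hi, hai, y, h2, hy⟩

namespace IsTropicalRoots

variable (hα : IsTropicalRoots d a α)

include hα

theorem mem_newtonVertices_of_lt (h0 : 0 < a 0) (hd : 0 < a d) {k : ℕ} (hk1 : 1 ≤ k)
    (hkd : k < d) (hlt : α k < α (k + 1)) : k ∈ newtonVertices d a := by
  obtain ⟨h1, x, hx, h⟩ := hα.coeff_eq_and_lt_of_lt h0 hd hk1 hkd hlt
  exact TropEig.mem_newtonVertices_of_lt hkd.le (h1 ▸ mul_pos hd (hα.tail_pos h0 k)) hx h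

theorem coeff_eq_of_forall_lt (h0 : 0 < a 0) (hd : 0 < a d) {k : ℕ} (hkd : k ≤ d)
    (hlt : 1 ≤ k → k < d → α k < α (k + 1)) : a k = a d * ∏ l ∈ Finset.Ioc k d, α l := by
  rcases Nat.eq_zero_or_pos k with rfl | hpos
  · exact hα.coeff_zero_eq h0
  rcases hkd.eq_or_lt with rfl | hkd
  · simp
  · exact (hα.coeff_eq_and_lt_of_lt h0 hd hpos hkd (hlt hpos hkd)).1

/-- A repeated root means that the polygon is straight around `k`: then `k` is interior to an edge,
and no point above it is extreme. -/
theorem lt_of_mem_newtonVertices (h0 : 0 < a 0) (hd : 0 < a d) {k : ℕ} (hk1 : 1 ≤ k)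
    (hkd : k < d) (hk : k ∈ newtonVertices d a) : α k < α (k + 1) := by
  by_contra hlt
  have heq : α (k + 1) = α k :=
    le_antisymm (not_lt.1 hlt) (hα.le_of_le hk1 (Nat.le_succ k) hkd)
  obtain ⟨-, hak, y, hy, hext⟩ := le_and_pos_of_mem_newtonVertices hk
  have hex : ∃ s, s < k ∧ α (s + 1) = α k := ⟨k - 1, by omega, by congr 1; omega⟩
  classical
  -- The roots equal to `α k` are exactly those with index in `(s, t]`. Since the roots jump at `s`
  -- and `t`, or these are the ends `0` and `d`, both `a s` and `a t` lie on the polygon.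
  set s := Nat.find hex with hs
  obtain ⟨hsk, hsα⟩ := Nat.find_spec hex
  rw [← hs] at hsk hsα
  set t := Nat.findGreatest (fun t => α t = α k) d with ht
  have hkt : k + 1 ≤ t := Nat.le_findGreatest hkd heq
  have htα : α t = α k := Nat.findGreatest_spec (P := fun t => α t = α k) hkd heq
  have htd : t ≤ d := Nat.findGreatest_le d
  have hst : ∀ l, s < l → l ≤ t → α l = α k := fun l h1 h2 => le_antisymm
    ((hα.le_of_le (by omega) h2 htd).trans_eq htα)
    (hsα.symm.trans_le (hα.le_of_le (by omega) h1 (by omega)))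
  have has : a s = a d * ∏ l ∈ Finset.Ioc s d, α l := by
    refine hα.coeff_eq_of_forall_lt h0 hd (by omega) fun h1 h2 => ?_
    refine lt_of_le_of_ne (hα.le_of_le h1 (Nat.le_succ s) h2) fun h => ?_
    refine Nat.find_min hex (m := s - 1) (by omega) ⟨by omega, ?_⟩
    rw [Nat.sub_add_cancel h1, h, hsα]
  have hat : a t = a d * ∏ l ∈ Finset.Ioc t d, α l := by
    refine hα.coeff_eq_of_forall_lt h0 hd htd fun h1 h2 => ?_
    refine lt_of_le_of_ne (hα.le_of_le h1 (Nat.le_succ t) h2) fun h => ?_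
    exact Nat.findGreatest_is_greatest (P := fun t => α t = α k) (n := d) (k := t + 1)
      (Nat.lt_succ_self t) h2 (h ▸ htα)
  have hβ : 0 < α k := hα.root_pos h0 hk1 hkd.le
  have hprod : ∀ i, s ≤ i → i ≤ t →
      Real.log (a d * ∏ l ∈ Finset.Ioc i d, α l) = Real.log (a t) + ((t : ℝ) - i) * Real.log (α k) := by
    intro i h1 h2
    have : ∏ l ∈ Finset.Ioc i t, α l = α k ^ (t - i) := by
      rw [Finset.prod_congr rfl fun l hl => hst l (by have := Finset.mem_Ioc.1 hl; omega)
        (Finset.mem_Ioc.1 hl).2]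
      simp
    rw [← Finset.prod_Ioc_consecutive α h2 htd, this, mul_left_comm, ← hat, mul_comm,
      Real.log_mul (by rw [hat]; exact (mul_pos hd (hα.tail_pos h0 t)).ne') (by positivity),
      Real.log_pow, Nat.cast_sub h2]
  have hs' := hprod s le_rfl (by omega)
  have hk' := hprod k hsk.le (by omega)
  rw [← has] at hs'
  have hle := Real.log_le_log hak (hα.coeff_le h0 hkd.le)
  rw [hk'] at hle
  have hs0 : 0 < a s := has ▸ mul_pos hd (hα.tail_pos h0 s)
  have ht0 : 0 < a t := hat ▸ mul_pos hd (hα.tail_pos h0 t)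
  -- `e` is the height of the edge above the supposed extreme point. Lowering both ends of the edge
  -- by `e` stays in the region and gives a segment through that point.
  set e : ℝ := Real.log (a t) + ((t : ℝ) - k) * Real.log (α k) - y with he
  have he0 : 0 ≤ e := by linarith
  have hsk' : (s : ℝ) < k := by exact_mod_cast hsk
  have hkt' : (k : ℝ) < t := by exact_mod_cast hkt
  have hpos : 0 < (t : ℝ) - s := by linarith
  have := (mem_extremePoints.1 hext).2 ((s : ℝ), Real.log (a s) - e)
    (subset_convexHull ℝ _ ⟨s, by omega, hs0, rfl, by simpa using he0⟩)
    ((t : ℝ), Real.log (a t) - e)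
    (subset_convexHull ℝ _ ⟨t, htd, ht0, rfl, by simpa using he0⟩)
    ⟨((t : ℝ) - k) / (t - s), ((k : ℝ) - s) / (t - s), div_pos (by linarith) hpos,
      div_pos (by linarith) hpos, by field_simp; ring, by
        rw [hs', he]
        ext
        · simp; field_simp; ring
        · simp; field_simp; ring⟩
  have h1 := congrArg Prod.fst this.1
  simp only [Nat.cast_inj] at h1
  omega

theorem coeff_eq_of_mem_newtonVertices (h0 : 0 < a 0) (hd : 0 < a d) {k : ℕ}
    (hk : k ∈ newtonVertices d a) : a k = a d * ∏ l ∈ Finset.Ioc k d, α l :=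
  hα.coeff_eq_of_forall_lt h0 hd (le_and_pos_of_mem_newtonVertices hk).1
    fun h1 h2 => hα.lt_of_mem_newtonVertices h0 hd h1 h2 hk

/-- The bound on the coefficients below a vertex. -/
theorem coeff_le_mul_pow (h0 : 0 < a 0) (hd : 0 < a d) {k i : ℕ} (hk : k ∈ newtonVertices d a)
    (hik : i ≤ k) : a i ≤ a k * α k ^ (k - i) := by
  have hkd := (le_and_pos_of_mem_newtonVertices hk).1
  refine (hα.coeff_le h0 (hik.trans hkd)).trans ?_
  rw [hα.coeff_eq_of_mem_newtonVertices h0 hd hk, ← Finset.prod_Ioc_consecutive α hik hkd,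
    mul_comm (∏ l ∈ Finset.Ioc i k, α l), ← mul_assoc]
  refine mul_le_mul_of_nonneg_left ?_ (mul_pos hd (hα.tail_pos h0 k)).le
  have : α k ^ (k - i) = ∏ l ∈ Finset.Ioc i k, α k := by simp
  rw [this]
  refine Finset.prod_le_prod (fun l hl => ?_) (fun l hl => ?_)
  all_goals have := Finset.mem_Ioc.1 hl
  · exact (hα.root_pos h0 (by omega) (by omega)).le
  · exact hα.le_of_le (by omega) (by omega) hkd

/-- The bound on the coefficients above a vertex. -/
theorem coeff_mul_pow_le (h0 : 0 < a 0) (hd : 0 < a d) {k i : ℕ} (hk : k ∈ newtonVertices d a)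
    (hki : k ≤ i) (hid : i ≤ d) : a i * α (k + 1) ^ (i - k) ≤ a k := by
  rw [hα.coeff_eq_of_mem_newtonVertices h0 hd hk, ← Finset.prod_Ioc_consecutive α hki hid,
    mul_comm (∏ l ∈ Finset.Ioc k i, α l), ← mul_assoc]
  have : α (k + 1) ^ (i - k) = ∏ l ∈ Finset.Ioc k i, α (k + 1) := by simp
  have hnn : ∀ l ∈ Finset.Ioc k i, 0 ≤ α (k + 1) := fun l hl => by
    have := Finset.mem_Ioc.1 hl
    exact (hα.root_pos h0 (by omega) (by omega)).le
  rw [this]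
  refine mul_le_mul (hα.coeff_le h0 hid) ?_ (Finset.prod_nonneg hnn)
    (mul_pos hd (hα.tail_pos h0 i)).le
  refine Finset.prod_le_prod hnn (fun l hl => ?_)
  have := Finset.mem_Ioc.1 hl
  exact hα.le_of_le (by omega) (by omega) (by omega)

/-- The ratio of the coefficients at two consecutive vertices. -/
theorem coeff_eq_mul_pow_of_consecutive (h0 : 0 < a 0) (hd : 0 < a d) {k m : ℕ}
    (hk : k ∈ newtonVertices d a) (hm : m ∈ newtonVertices d a) (hkm : k < m)
    (h : ∀ l, k < l → l < m → l ∉ newtonVertices d a) : a k = a m * α m ^ (m - k) := by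
  have hmd := (le_and_pos_of_mem_newtonVertices hm).1
  -- Descending from `m`, a strict jump of the roots would create a vertex strictly between `k` and
  -- `m`.
  have hconst : ∀ i, i < m - k → α (m - i) = α m := by
    intro i
    induction i with
    | zero => intro _; rfl
    | succ i ih =>
      intro hi
      rw [← ih (by omega)]
      have e : m - i = m - (i + 1) + 1 := by omega
      rw [e]
      by_contra hne
      exact h (m - (i + 1)) (by omega) (by omega) (hα.mem_newtonVertices_of_lt h0 hd (by omega)
        (by omega) (lt_of_le_of_ne (hα.le_of_le (by omega) (by omega) (by omega)) hne))
  rw [hα.coeff_eq_of_mem_newtonVertices h0 hd hk, hα.coeff_eq_of_mem_newtonVertices h0 hd hm,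
    ← Finset.prod_Ioc_consecutive α hkm.le hmd]
  have : ∏ l ∈ Finset.Ioc k m, α l = ∏ l ∈ Finset.Ioc k m, α m := by
    refine Finset.prod_congr rfl fun l hl => ?_
    have := Finset.mem_Ioc.1 hl
    rw [← hconst (m - l) (by omega)]
    congr 1
    omega
  rw [this, Finset.prod_const, Nat.card_Ioc]
  ring

end IsTropicalRoots

end Tropical

/-! ### Hadamard bounds and the coefficients of det P. -/

section Determinants

variable {n : ℕ}

/-- **Hadamard's inequality**. -/
theorem norm_det_le_prod_norm_col (M : Matrix (Fin n) (Fin n) ℂ) :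
    ‖M.det‖ ≤ ∏ i, ‖(WithLp.toLp 2 (fun l => M l i) : EuclideanSpace ℂ (Fin n))‖ := by
  set f : Fin n → EuclideanSpace ℂ (Fin n) := fun i => WithLp.toLp 2 (fun l => M l i) with hf
  set b := EuclideanSpace.basisFun (Fin n) ℂ with hb
  set g := InnerProductSpace.gramSchmidtOrthonormalBasis (𝕜 := ℂ) (by simp) f with hg
  have h1 : b.toBasis.det f = M.det := by
    rw [Module.Basis.det_apply]
    congr 1
  -- Gram–Schmidt: the change between orthonormal bases has determinant of modulus one, and the
  -- other factor is triangular with diagonal ⟨g i, f i⟩, bounded by Cauchy–Schwarz.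
  have h2 : b.toBasis.det f = b.toBasis.det g * g.toBasis.det f := by
    conv_lhs => rw [AlternatingMap.eq_smul_basis_det g.toBasis b.toBasis.det]
    simp
  rw [← h1, h2, norm_mul, OrthonormalBasis.det_to_matrix_orthonormalBasis, one_mul, hg,
    InnerProductSpace.gramSchmidtOrthonormalBasis_det, norm_prod]
  refine Finset.prod_le_prod (fun i _ => norm_nonneg _) fun i _ => ?_
  refine (norm_inner_le_norm _ _).trans ?_
  simp [hf]

theorem prod_le_mean_pow (z : Fin n → ℝ) (hz : ∀ i, 0 ≤ z i) :
    ∏ i, z i ≤ ((1 / (n : ℝ)) * ∑ i, z i) ^ n := by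
  rcases Nat.eq_zero_or_pos n with rfl | hn
  · simp
  have hn' : (n : ℝ) ≠ 0 := by positivity
  have h := Real.geom_mean_le_arith_mean_weighted Finset.univ (fun _ => 1 / (n : ℝ)) z
    (fun _ _ => by positivity) (by simp [hn']) (fun i _ => hz i)
  have h' := pow_le_pow_left₀
    (Finset.prod_nonneg fun i _ => Real.rpow_nonneg (hz i) _) h n
  rw [← Finset.prod_pow, ← Finset.mul_sum] at h'
  refine le_trans (le_of_eq ?_) h'
  refine Finset.prod_congr rfl fun i _ => ?_
  rw [← Real.rpow_natCast, ← Real.rpow_mul (hz i), one_div_mul_cancel hn', Real.rpow_one]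

theorem sq_normFrob (M : Matrix (Fin n) (Fin n) ℂ) :
    normFrob M ^ 2 = (1 / (n : ℝ)) * ∑ i, ∑ j, ‖M i j‖ ^ 2 :=
  Real.sq_sqrt (by positivity)

theorem normFrob_nonneg (M : Matrix (Fin n) (Fin n) ℂ) : 0 ≤ normFrob M := Real.sqrt_nonneg _

/-- Hadamard's inequality squared, then the inequality of arithmetic and geometric means for the
squared column norms. -/
theorem norm_det_le_normFrob_pow (M : Matrix (Fin n) (Fin n) ℂ) : ‖M.det‖ ≤ normFrob M ^ n := by
  refine le_of_sq_le_sq ?_ (pow_nonneg (normFrob_nonneg M) n)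
  rw [← pow_mul, mul_comm n 2, pow_mul, sq_normFrob]
  refine (pow_le_pow_left₀ (norm_nonneg _) (norm_det_le_prod_norm_col M) 2).trans ?_
  rw [← Finset.prod_pow, Finset.sum_comm]
  simp only [EuclideanSpace.norm_sq_eq]
  exact prod_le_mean_pow _ fun i => by positivity

theorem norm_det_le_pow {ν : Seminorm ℂ (Matrix (Fin n) (Fin n) ℂ)} (hν : DominatesFrob ν)
    (M : Matrix (Fin n) (Fin n) ℂ) : ‖M.det‖ ≤ ν M ^ n := by
  obtain ⟨Q, Q', hQ, hQ', h⟩ := hν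
  have := norm_det_le_normFrob_pow (Q * M * Q')
  rw [Matrix.det_mul, Matrix.det_mul, hQ, hQ', one_mul, mul_one] at this
  exact this.trans (pow_le_pow_left₀ (normFrob_nonneg _) (h M) n)

/-- The columns are bounded in terms of a norm dominating the Frobenius norm. -/
theorem exists_norm_col_le {ν : Seminorm ℂ (Matrix (Fin n) (Fin n) ℂ)} (hν : DominatesFrob ν)
    (i : Fin n) : ∃ t : ℝ, 0 < t ∧ ∀ M : Matrix (Fin n) (Fin n) ℂ,
      ‖(WithLp.toLp 2 (fun l => M l i) : EuclideanSpace ℂ (Fin n))‖ ≤ t * ν M := by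
  obtain ⟨Q, Q', hQ, hQ', h⟩ := hν
  have hn : 0 < (n : ℝ) := by exact_mod_cast i.pos
  have hent : ∀ M : Matrix (Fin n) (Fin n) ℂ, ∀ r s, ‖(Q * M * Q') r s‖ ≤ √n * ν M := by
    intro M r s
    refine le_trans ?_ (mul_le_mul_of_nonneg_left (h M) (Real.sqrt_nonneg _))
    refine le_of_sq_le_sq ?_ (mul_nonneg (Real.sqrt_nonneg _) (normFrob_nonneg _))
    rw [mul_pow, Real.sq_sqrt hn.le, sq_normFrob, ← mul_assoc, mul_one_div_cancel hn.ne', one_mul]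
    refine le_trans ?_ (Finset.single_le_sum
      (f := fun r => ∑ s, ‖(Q * M * Q') r s‖ ^ 2) (fun _ _ => by positivity) (Finset.mem_univ r))
    exact Finset.single_le_sum (f := fun s => ‖(Q * M * Q') r s‖ ^ 2)
      (fun _ _ => by positivity) (Finset.mem_univ s)
  set t : ℝ := ∑ l, ∑ s, ∑ r, ‖Q⁻¹ l r‖ * √n * ‖Q'⁻¹ s i‖ with ht
  have ht0 : 0 ≤ t := by positivity
  refine ⟨t + 1, by positivity, fun M => ?_⟩
  have hM : M = Q⁻¹ * (Q * M * Q') * Q'⁻¹ := by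
    rw [Matrix.mul_assoc, Matrix.mul_assoc, Matrix.mul_nonsing_inv _ (by simp [hQ']),
      Matrix.mul_one, ← Matrix.mul_assoc, Matrix.nonsing_inv_mul _ (by simp [hQ]), Matrix.one_mul]
  have hl : ∀ l, ‖M l i‖ ≤ (∑ s, ∑ r, ‖Q⁻¹ l r‖ * √n * ‖Q'⁻¹ s i‖) * ν M := by
    intro l
    conv_lhs => rw [hM, Matrix.mul_apply]
    rw [Finset.sum_mul]
    refine (norm_sum_le _ _).trans (Finset.sum_le_sum fun s _ => ?_)
    rw [norm_mul, Matrix.mul_apply, Finset.sum_mul]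
    refine (mul_le_mul_of_nonneg_right (norm_sum_le _ _) (norm_nonneg _)).trans ?_
    rw [Finset.sum_mul]
    refine Finset.sum_le_sum fun r _ => ?_
    rw [norm_mul]
    calc ‖Q⁻¹ l r‖ * ‖(Q * M * Q') r s‖ * ‖Q'⁻¹ s i‖
        ≤ ‖Q⁻¹ l r‖ * (√n * ν M) * ‖Q'⁻¹ s i‖ := by gcongr; exact hent M r s
      _ = _ := by ring
  have hν0 : 0 ≤ ν M := apply_nonneg ν M
  calc ‖(WithLp.toLp 2 (fun l => M l i) : EuclideanSpace ℂ (Fin n))‖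
      ≤ ∑ l, ‖M l i‖ := by
        rw [EuclideanSpace.norm_eq, Real.sqrt_le_left (by positivity)]
        exact Finset.sum_sq_le_sq_sum_of_nonneg fun l _ => norm_nonneg _
    _ ≤ t * ν M := by
        rw [ht, Finset.sum_mul]
        exact Finset.sum_le_sum fun l _ => hl l
    _ ≤ (t + 1) * ν M := by nlinarith

theorem colConst_nonneg (ν : Seminorm ℂ (Matrix (Fin n) (Fin n) ℂ)) (i : Fin n) :
    0 ≤ colConst ν i :=
  Real.sInf_nonneg fun _ h => h.1.le

/-- The infimum defining `colConst` satisfies the inequality itself. When `ν M = 0` one cannot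
divide, but any admissible constant shows that the column vanishes. -/
theorem norm_col_le {ν : Seminorm ℂ (Matrix (Fin n) (Fin n) ℂ)} (hν : DominatesFrob ν)
    (i : Fin n) (M : Matrix (Fin n) (Fin n) ℂ) :
    ‖(WithLp.toLp 2 (fun l => M l i) : EuclideanSpace ℂ (Fin n))‖ ≤ colConst ν i * ν M := by
  obtain ⟨t, ht⟩ := exists_norm_col_le hν i
  rcases (apply_nonneg ν M).eq_or_lt with h0 | hpos
  · have := ht.2 M
    rwa [← h0, mul_zero] at this ⊢
  · rw [← div_le_iff₀ hpos]
    refine le_csInf ⟨t, ht⟩ fun s hs => ?_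
    rw [div_le_iff₀ hpos]
    exact hs.2 M

/-- The matrix whose `i`-th column is the `i`-th column of `A (φ i)`. -/
def mixedCols (A : ℕ → Matrix (Fin n) (Fin n) ℂ) (φ : Fin n → ℕ) : Matrix (Fin n) (Fin n) ℂ :=
  Matrix.of fun l i => A (φ i) l i

theorem norm_det_mixedCols_le {ν : Seminorm ℂ (Matrix (Fin n) (Fin n) ℂ)} (hν : DominatesFrob ν)
    (A : ℕ → Matrix (Fin n) (Fin n) ℂ) (φ : Fin n → ℕ) :
    ‖(mixedCols A φ).det‖ ≤ (∏ i, colConst ν i) * ∏ i, ν (A (φ i)) := by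
  rw [← Finset.prod_mul_distrib]
  exact (norm_det_le_prod_norm_col _).trans
    (Finset.prod_le_prod (fun _ _ => norm_nonneg _) fun i _ => norm_col_le hν i (A (φ i)))

/-- Multilinearity of the determinant in the columns, where `φ` selects the summand used in each
column. The transpose appears because the alternating map of Mathlib acts on rows. -/
theorem detPoly_eq_sum (d : ℕ) (A : ℕ → Matrix (Fin n) (Fin n) ℂ) :
    detPoly d A = ∑ φ : Fin n → Fin (d + 1),
      Polynomial.X ^ (∑ i, (φ i : ℕ)) * Polynomial.C (mixedCols A fun i => φ i).det := by
  have h := MultilinearMap.map_sum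
    (Matrix.detRowAlternating (n := Fin n) (R := Polynomial ℂ)).toMultilinearMap
    (fun (i : Fin n) (j : Fin (d + 1)) =>
      (Polynomial.X ^ (j : ℕ) : Polynomial ℂ) • fun l => Polynomial.C (A j l i))
  have h1 : detPoly d A = (Matrix.detRowAlternating (n := Fin n) (R := Polynomial ℂ)).toMultilinearMap
      (fun i => ∑ j : Fin (d + 1), (Polynomial.X ^ (j : ℕ) : Polynomial ℂ) •
        fun l => Polynomial.C (A j l i)) := by
    rw [detPoly, ← Matrix.det_transpose]
    change Matrix.det _ = Matrix.det _
    congr 1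
    ext1 i l
    rw [Matrix.transpose_apply, Finset.sum_range, Matrix.sum_apply, Finset.sum_apply]
    rfl
  rw [h1, h]
  refine Finset.sum_congr rfl fun φ _ => ?_
  rw [MultilinearMap.map_smul_univ, Finset.prod_pow_eq_pow_sum, smul_eq_mul]
  congr 1
  rw [RingHom.map_det, ← Matrix.det_transpose]
  rfl

theorem coeff_detPoly (d : ℕ) (A : ℕ → Matrix (Fin n) (Fin n) ℂ) (m : ℕ) :
    (detPoly d A).coeff m = ∑ φ : Fin n → Fin (d + 1) with ∑ i, (φ i : ℕ) = m,
      (mixedCols A fun i => φ i).det := by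
  rw [detPoly_eq_sum, Polynomial.finsetSum_coeff, Finset.sum_filter]
  refine Finset.sum_congr rfl fun φ _ => ?_
  rw [mul_comm, Polynomial.coeff_C_mul, Polynomial.coeff_X_pow]
  simp [eq_comm]

theorem natDegree_detPoly_le (d : ℕ) (A : ℕ → Matrix (Fin n) (Fin n) ℂ) :
    (detPoly d A).natDegree ≤ n * d := by
  rw [Polynomial.natDegree_le_iff_coeff_eq_zero]
  intro m hm
  rw [coeff_detPoly, Finset.filter_eq_empty_iff.2, Finset.sum_empty]
  intro φ _ h
  have : ∑ i, (φ i : ℕ) ≤ ∑ i : Fin n, d :=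
    Finset.sum_le_sum fun i _ => Nat.lt_succ_iff.1 (φ i).2
  simp at this
  omega

theorem eval_detPoly (d : ℕ) (A : ℕ → Matrix (Fin n) (Fin n) ℂ) (z : ℂ) :
    (detPoly d A).eval z = (∑ j ∈ Finset.range (d + 1), z ^ j • A j).det := by
  rw [detPoly, ← Polynomial.coe_evalRingHom, RingHom.map_det]
  congr 1
  ext i l
  simp [Matrix.sum_apply, mul_comm (A _ i l)]

/-- The coefficient of `detPoly` at a multiple of the size of the matrices is close to the
determinant of the corresponding matrix, if the mixed products of norms are small. -/
theorem norm_coeff_detPoly_sub_det_le {d : ℕ} {ν : Seminorm ℂ (Matrix (Fin n) (Fin n) ℂ)}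
    (hν : DominatesFrob ν) (A : ℕ → Matrix (Fin n) (Fin n) ℂ) {k : ℕ} (hk : k ≤ d) {ε : ℝ}
    (hε : ∀ φ : Fin n → ℕ, (∀ i, φ i ≤ d) → ∑ i, φ i = n * k → (∃ i, φ i ≠ k) →
      ∏ i, ν (A (φ i)) ≤ ε) :
    ‖(detPoly d A).coeff (n * k) - (A k).det‖ ≤
      ((numMaps n d (n * k) : ℝ) - 1) * (∏ i, colConst ν i) * ε := by
  -- The constant map contributes det A_k; removing it accounts for the `- 1` in the count.
  set φ₀ : Fin n → Fin (d + 1) := fun _ => ⟨k, Nat.lt_succ_of_le hk⟩ with hφ₀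
  have hmem : φ₀ ∈ Finset.univ.filter (fun φ : Fin n → Fin (d + 1) => ∑ i, (φ i : ℕ) = n * k) := by
    simp [hφ₀]
  have hdet : (mixedCols A fun i => (φ₀ i : ℕ)).det = (A k).det := rfl
  rw [coeff_detPoly, ← Finset.add_sum_erase _ _ hmem, hdet, add_sub_cancel_left]
  refine (norm_sum_le_of_le _ (f := fun φ : Fin n → Fin (d + 1) => (mixedCols A fun i => φ i).det)
    (n := fun _ => (∏ i, colConst ν i) * ε) ?_).trans ?_
  · intro φ hφ
    obtain ⟨hne, hφ⟩ := Finset.mem_erase.1 hφ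
    refine (norm_det_mixedCols_le hν A _).trans (mul_le_mul_of_nonneg_left ?_
      (Finset.prod_nonneg fun i _ => colConst_nonneg ν i))
    refine hε _ (fun i => Nat.lt_succ_iff.1 (φ i).2) (Finset.mem_filter.1 hφ).2 ?_
    by_contra! hall
    exact hne (funext fun i => Fin.ext (hall i))
  · rw [Finset.sum_const, nsmul_eq_mul, Finset.card_erase_of_mem hmem,
      Nat.cast_pred (Finset.card_pos.2 ⟨_, hmem⟩), numMaps, mul_assoc]

end Determinants

/-! ### Mixed products of norms at a vertex. -/

section Separation

variable {d : ℕ} {a α : ℕ → ℝ}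

namespace IsTropicalRoots

variable (hα : IsTropicalRoots d a α)

include hα

theorem separation_mem_Ico (h0 : 0 < a 0) (hd : 0 < a d) {k : ℕ} (hk : k ∈ newtonVertices d a) :
    separation d α k ∈ Set.Ico 0 1 := by
  unfold separation
  split_ifs with h
  · simp
  · have hkd := (le_and_pos_of_mem_newtonVertices hk).1
    have h1 : 0 < α (k + 1) := hα.root_pos h0 (by omega) (by omega)
    have h2 := hα.root_pos h0 (l := k) (by omega) (by omega)
    have h3 := hα.lt_of_mem_newtonVertices h0 hd (by omega) (by omega) hk
    exact ⟨by positivity, by rwa [div_lt_one h1]⟩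

/-- A nonconstant `φ` of mean `k` takes values on both sides of `k`, so `k` is neither `0` nor `d`.
The total deviations below and above `k` agree, so the decay factors combine into a power of the
separation ratio with exponent at least one. -/
theorem prod_coeff_le (h0 : 0 < a 0) (hd : 0 < a d) (ha : ∀ i, 0 ≤ a i) {k n : ℕ}
    (hk : k ∈ newtonVertices d a)
    (φ : Fin n → ℕ) (hφ : ∀ i, φ i ≤ d) (hsum : ∑ i, φ i = n * k) (hne : ∃ i, φ i ≠ k) :
    ∏ i, a (φ i) ≤ a k ^ n * separation d α k := by
  obtain ⟨hkd, hak, -⟩ := le_and_pos_of_mem_newtonVertices hk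
  have hlt : ∃ i, φ i < k := by
    by_contra! hge
    obtain ⟨i, hi⟩ := hne
    have : ∑ i : Fin n, k < ∑ i, φ i :=
      Finset.sum_lt_sum (fun i _ => hge i)
        ⟨i, Finset.mem_univ i, lt_of_le_of_ne (hge i) (Ne.symm hi)⟩
    simp [hsum] at this
  have hgt : ∃ i, k < φ i := by
    by_contra! hle
    obtain ⟨i, hi⟩ := hne
    have : ∑ i, φ i < ∑ i : Fin n, k :=
      Finset.sum_lt_sum (fun i _ => hle i)
        ⟨i, Finset.mem_univ i, lt_of_le_of_ne (hle i) hi⟩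
    simp [hsum] at this
  obtain ⟨i₀, hi₀⟩ := hlt
  obtain ⟨i₁, hi₁⟩ := hgt
  have hk1 : 1 ≤ k := by omega
  have hkd' : k < d := hi₁.trans_le (hφ i₁)
  have hδ := hα.separation_mem_Ico h0 hd hk
  have hsep : separation d α k = α k / α (k + 1) := if_neg (by omega)
  rw [hsep] at hδ ⊢
  have hβ : 0 < α (k + 1) := hα.root_pos h0 (by omega) (by omega)
  have hα0 := hα.root_pos h0 hk1 hkd
  have hterm : ∀ i, a (φ i) ≤ a k * (α k ^ (k - φ i) / α (k + 1) ^ (φ i - k)) := by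
    intro i
    rcases le_total (φ i) k with h | h
    · simpa [Nat.sub_eq_zero_of_le h] using hα.coeff_le_mul_pow h0 hd hk h
    · have := hα.coeff_mul_pow_le h0 hd hk h (hφ i)
      rw [← le_div_iff₀ (pow_pos hβ _)] at this
      simpa [Nat.sub_eq_zero_of_le h, div_eq_mul_inv] using this
  have hS : ∑ i, (k - φ i) = ∑ i, (φ i - k) := by
    have h1 : ∑ i, ((k - φ i) + φ i) = ∑ i, ((φ i - k) + k) :=
      Finset.sum_congr rfl fun i _ => by omega
    rw [Finset.sum_add_distrib, Finset.sum_add_distrib, hsum] at h1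
    simpa using h1
  have hS1 : 1 ≤ ∑ i, (k - φ i) :=
    le_trans (by omega) (Finset.single_le_sum (f := fun i => k - φ i) (fun _ _ => Nat.zero_le _)
      (Finset.mem_univ i₀))
  calc ∏ i, a (φ i) ≤ ∏ i, a k * (α k ^ (k - φ i) / α (k + 1) ^ (φ i - k)) :=
        Finset.prod_le_prod (fun i _ => ha _) fun i _ => hterm i
    _ = a k ^ n * (α k / α (k + 1)) ^ (∑ i, (k - φ i)) := by
        rw [Finset.prod_mul_distrib, Finset.prod_div_distrib, Finset.prod_pow_eq_pow_sum,
          Finset.prod_pow_eq_pow_sum, ← hS, div_pow]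
        simp
    _ ≤ a k ^ n * (α k / α (k + 1)) := by
        gcongr
        exact pow_le_of_le_one hδ.1 hδ.2.le (by omega)

end IsTropicalRoots

end Separation

/-! ### Mahler measure, roots and coefficients. -/

section Roots

open Polynomial

theorem natDegree_comp_ofReal_mul_X {p : ℂ[X]} {r : ℝ} (hr : 0 < r) :
    (p.comp (C (r : ℂ) * X)).natDegree = p.natDegree := by
  rw [natDegree_comp, natDegree_C_mul_X _ (by exact_mod_cast hr.ne'), mul_one]

theorem comp_C_mul_X_ne_zero {p : ℂ[X]} (hp : p ≠ 0) {r : ℝ} (hr : 0 < r) :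
    p.comp (C (r : ℂ) * X) ≠ 0 := by
  intro h
  refine hp (Polynomial.ext fun m => ?_)
  have h1 := congrArg (fun q => q.coeff m) h
  simp only [comp_C_mul_X_coeff, coeff_zero, mul_eq_zero] at h1
  simpa using h1.resolve_right (pow_ne_zero _ (by exact_mod_cast hr.ne'))

/-- Jensen's formula on the circle of radius `r`, rescaled to the unit circle: each factor `r X - z`
has Mahler measure `max r ‖z‖`. -/
theorem mahlerMeasure_comp_C_mul_X (p : ℂ[X]) {r : ℝ} (hr : 0 < r) :
    (p.comp (C (r : ℂ) * X)).mahlerMeasure =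
      ‖p.leadingCoeff‖ * (p.roots.map fun z => max r ‖z‖).prod := by
  conv_lhs => rw [(IsAlgClosed.splits p).eq_prod_roots]
  rw [mul_comp, C_comp, mahlerMeasure_mul, mahlerMeasure_const, multiset_prod_comp,
    prod_mahlerMeasure_eq_mahlerMeasure_prod, Multiset.map_map, Multiset.map_map]
  congr 3
  funext z
  have h := mahlerMeasure_C_mul_X_add_C (a := (r : ℂ)) (by exact_mod_cast hr.ne') (-z)
  simpa [abs_of_pos hr, sub_eq_add_neg] using h

variable {p : ℂ[X]} {N : ℕ} {ζ : ℕ → ℂ}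

theorem natDegree_eq_of_roots (hroots : (Finset.Icc 1 N).val.map ζ = p.roots) :
    p.natDegree = N := by
  rw [(IsAlgClosed.splits p).natDegree_eq_card_roots, ← hroots]
  simp

theorem mahlerMeasure_comp_eq_prod (hroots : (Finset.Icc 1 N).val.map ζ = p.roots)
    {r : ℝ} (hr : 0 < r) : (p.comp (C (r : ℂ) * X)).mahlerMeasure =
      ‖p.leadingCoeff‖ * ∏ i ∈ Finset.Icc 1 N, max r ‖ζ i‖ := by
  rw [mahlerMeasure_comp_C_mul_X p hr, ← hroots, Multiset.map_map]
  rfl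

/-- A lower bound for a circle average of the logarithm in terms of the largest roots. -/
theorem pow_mul_prod_le_mahlerMeasure (hroots : (Finset.Icc 1 N).val.map ζ = p.roots)
    {r : ℝ} (hr : 0 < r) {m : ℕ} (hm : m ≤ N) :
    r ^ m * (‖p.leadingCoeff‖ * ∏ i ∈ Finset.Ioc m N, ‖ζ i‖) ≤
      (p.comp (C (r : ℂ) * X)).mahlerMeasure := by
  rw [mahlerMeasure_comp_eq_prod hroots hr, mul_left_comm]
  refine mul_le_mul_of_nonneg_left ?_ (norm_nonneg _)
  have : Finset.Icc 1 N = Finset.Ioc 0 N := rfl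
  rw [this, ← Finset.prod_Ioc_consecutive _ (Nat.zero_le m) hm]
  refine mul_le_mul ?_ (Finset.prod_le_prod (fun _ _ => norm_nonneg _)
    fun _ _ => le_max_right _ _) (Finset.prod_nonneg fun _ _ => norm_nonneg _)
    (Finset.prod_nonneg fun _ _ => hr.le.trans (le_max_left _ _))
  have h : r ^ m = ∏ i ∈ Finset.Ioc 0 m, r := by simp
  rw [h]
  exact Finset.prod_le_prod (fun _ _ => hr.le) fun _ _ => le_max_left _ _

theorem norm_coeff_zero_eq_prod (hroots : (Finset.Icc 1 N).val.map ζ = p.roots) :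
    ‖p.coeff 0‖ = ‖p.leadingCoeff‖ * ∏ i ∈ Finset.Ioc 0 N, ‖ζ i‖ := by
  rw [(IsAlgClosed.splits p).coeff_zero_eq_leadingCoeff_mul_prod_roots, ← hroots]
  simp only [norm_mul, norm_pow, norm_neg, norm_one, one_pow, one_mul]
  congr 1
  change ‖∏ i ∈ Finset.Icc 1 N, ζ i‖ = _
  rw [norm_prod]
  rfl

/-- A coefficient is bounded in terms of the product of the largest roots. -/
theorem norm_coeff_le_choose_mul_prod (hroots : (Finset.Icc 1 N).val.map ζ = p.roots)
    (hmono : MonotoneOn (fun i => ‖ζ i‖) (Set.Icc 1 N)) (h0 : p.coeff 0 ≠ 0) {m : ℕ}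
    (hm : m ≤ N) : ‖p.coeff m‖ ≤
      (N.choose m : ℝ) * (‖p.leadingCoeff‖ * ∏ i ∈ Finset.Ioc m N, ‖ζ i‖) := by
  rcases Nat.eq_zero_or_pos m with rfl | hpos
  · simp [norm_coeff_zero_eq_prod hroots]
  have hr : 0 < ‖ζ m‖ := by
    rw [norm_pos_iff]
    intro h
    refine h0 ?_
    rw [← norm_eq_zero, norm_coeff_zero_eq_prod hroots, Finset.prod_eq_zero (i := m)
      (Finset.mem_Ioc.2 ⟨hpos, hm⟩) (by simp [h]), mul_zero]
  -- At radius `‖ζ m‖` the Mahler measure is exactly `‖ζ m‖ ^ m` times the tail, and the power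
  -- cancels against the rescaled coefficient.
  have h := norm_coeff_le_choose_mul_mahlerMeasure m (p.comp (C ((‖ζ m‖ : ℝ) : ℂ) * X))
  rw [natDegree_comp_ofReal_mul_X hr, natDegree_eq_of_roots hroots,
    mahlerMeasure_comp_eq_prod hroots hr, prod_max_eq (α := fun i => ‖ζ i‖) hm
    (fun l hl => hmono ⟨(Finset.mem_Ioc.1 hl).1, (Finset.mem_Ioc.1 hl).2.trans hm⟩ ⟨hpos, hm⟩
      (Finset.mem_Ioc.1 hl).2)
    (fun l hl => hmono ⟨hpos, hm⟩ ⟨hpos.trans (Finset.mem_Ioc.1 hl).1, (Finset.mem_Ioc.1 hl).2⟩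
      (Finset.mem_Ioc.1 hl).1.le), comp_C_mul_X_coeff, norm_mul, norm_pow,
    Complex.norm_real, norm_norm] at h
  refine le_of_mul_le_mul_right ?_ (pow_pos hr m)
  linarith

end Roots

/-! ### Mahler measure of det P via Parseval. -/

section CircleAverages

open Polynomial

open MeasureTheory Set Filter in
/-- A continuous majorant of `log ‖p‖` outside of the zeros of `p` yields a bound on the Mahler
measure. -/
theorem logMahlerMeasure_le_circleAverage {p : ℂ[X]} (hp : p ≠ 0) {g : ℂ → ℝ} (hg : Continuous g)
    (h : ∀ z, p.eval z ≠ 0 → Real.log ‖p.eval z‖ ≤ g z) :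
    p.logMahlerMeasure ≤ Real.circleAverage g 0 1 := by
  rw [logMahlerMeasure_def, Real.circleAverage_def, Real.circleAverage_def, smul_eq_mul,
    smul_eq_mul]
  refine mul_le_mul_of_nonneg_left ?_ (by positivity)
  refine intervalIntegral.integral_mono_ae_restrict (by positivity)
    p.intervalIntegrable_mahlerMeasure
    ((hg.comp (continuous_circleMap 0 1)).intervalIntegrable _ _) ?_
  rw [EventuallyLE, eventually_iff_exists_mem]
  -- At a zero of `p` the convention `Real.log 0 = 0` could break the inequality; such angles form a
  -- finite, hence null, set. The endpoint 2π is set aside to make the circle map injective.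
  refine ⟨{x : ℝ | eval (circleMap 0 1 x) p ≠ 0}, ?_, fun x hx => h _ hx⟩
  rw [mem_ae_iff, compl_def, Measure.restrict_apply' (by simp)]
  apply (Finite.of_sdiff _ <| finite_singleton (2 * Real.pi)).measure_zero
  simp only [ne_eq, mem_ofPred_eq, Decidable.not_not, inter_sdiff_assoc, Icc_sdiff_right]
  rw [ofPred_inter_eq_sep]
  apply Finite.of_finite_image (f := circleMap 0 1) ((Multiset.finite_toSet p.roots).subset _)
    <| fun _ h _ k l ↦ injOn_circleMap_of_abs_sub_le' one_ne_zero (by linarith) h.1 k.1 l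
  simp [hp]

theorem circleAverage_sq_norm_sum (d : ℕ) (b : ℕ → ℂ) :
    Real.circleAverage (fun z => ‖∑ j ∈ Finset.range (d + 1), z ^ j * b j‖ ^ 2) 0 1 =
      ∑ j ∈ Finset.range (d + 1), ‖b j‖ ^ 2 := by
  set g : ℂ[X] := ∑ j ∈ Finset.range (d + 1), C (b j) * X ^ j with hg
  have hcoeff : ∀ j, g.coeff j = if j ∈ Finset.range (d + 1) then b j else 0 := by
    intro j
    simp [hg, finsetSum_coeff, coeff_C_mul, coeff_X_pow]
  have heval : ∀ z, g.eval z = ∑ j ∈ Finset.range (d + 1), z ^ j * b j := by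
    intro z
    simp [hg, eval_finsetSum, mul_comm (b _)]
  have h := g.sum_sq_norm_coeff_eq_circleAverage
  simp only [heval] at h
  rw [← h]
  have hsub : g.support ⊆ Finset.range (d + 1) := by
    intro j hj
    rw [mem_support_iff, hcoeff] at hj
    by_contra hj'
    exact hj (if_neg hj')
  rw [Finset.sum_subset hsub fun j _ hj => by simp [notMem_support_iff.1 hj]]
  exact Finset.sum_congr rfl fun j hj => by rw [hcoeff, if_pos hj]

/-- Hadamard's inequality gives log |det| ≤ (n/2) log ‖·‖_nF². By Parseval, the mean of ‖·‖_nF² over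
the circle is at most the sum on the right, and concavity of log moves the mean inside. -/
theorem mahlerMeasure_detPoly_le {n d : ℕ} (hn : 0 < n) {A : ℕ → Matrix (Fin n) (Fin n) ℂ}
    {ν : Seminorm ℂ (Matrix (Fin n) (Fin n) ℂ)} (hν : DominatesFrob ν)
    {r : ℝ} (hr : 0 < r) (hp : detPoly d A ≠ 0)
    (hS : 0 < ∑ j ∈ Finset.range (d + 1), (ν (A j) * r ^ j) ^ 2) :
    ((detPoly d A).comp (C (r : ℂ) * X)).mahlerMeasure ≤
      (∑ j ∈ Finset.range (d + 1), (ν (A j) * r ^ j) ^ 2) ^ ((n : ℝ) / 2) := by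
  obtain ⟨Q, Q', hQ, hQ', h⟩ := hν
  set S := ∑ j ∈ Finset.range (d + 1), (ν (A j) * r ^ j) ^ 2 with hSdef
  have hn' : (n : ℝ) ≠ 0 := by positivity
  have hq := comp_C_mul_X_ne_zero hp hr
  set q := (detPoly d A).comp (C (r : ℂ) * X) with hqdef
  set b : Fin n → Fin n → ℕ → ℂ := fun i l j => (r : ℂ) ^ j * (Q * A j * Q') i l with hb
  set B : ℂ → Matrix (Fin n) (Fin n) ℂ :=
    fun z => Matrix.of fun i l => ∑ j ∈ Finset.range (d + 1), z ^ j * b i l j with hB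
  have hdet : ∀ z, q.eval z = (B z).det := by
    intro z
    have h1 : B z = Q * (∑ j ∈ Finset.range (d + 1), ((r : ℂ) * z) ^ j • A j) * Q' := by
      rw [Matrix.mul_sum, Matrix.sum_mul]
      ext i l
      simp only [hB, hb, Matrix.of_apply, Matrix.sum_apply, Matrix.mul_smul, Matrix.smul_mul,
        Matrix.smul_apply, smul_eq_mul]
      exact Finset.sum_congr rfl fun j _ => by ring
    rw [h1, Matrix.det_mul, Matrix.det_mul, hQ, hQ', one_mul, mul_one, hqdef, eval_comp,
      ← eval_detPoly]
    simp
  have hsum : (1 / (n : ℝ)) * ∑ i, ∑ l, ∑ j ∈ Finset.range (d + 1), ‖b i l j‖ ^ 2 ≤ S := by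
    have e : ∑ i, ∑ l, ∑ j ∈ Finset.range (d + 1), ‖b i l j‖ ^ 2 =
        ∑ j ∈ Finset.range (d + 1), ∑ i, ∑ l, ‖b i l j‖ ^ 2 := by
      rw [Finset.sum_comm]
      simp_rw [Finset.sum_comm (s := Finset.univ) (t := Finset.range (d + 1))]
      refine Finset.sum_congr rfl fun j _ => ?_
      rw [Finset.sum_comm]
    rw [e, Finset.mul_sum, hSdef]
    refine Finset.sum_le_sum fun j _ => ?_
    have h2 : (1 / (n : ℝ)) * ∑ i, ∑ l, ‖b i l j‖ ^ 2 = (normFrob (Q * A j * Q') * r ^ j) ^ 2 := by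
      rw [mul_pow, sq_normFrob, mul_assoc, Finset.sum_mul]
      simp_rw [Finset.sum_mul]
      congr 1
      refine Finset.sum_congr rfl fun i _ => Finset.sum_congr rfl fun l _ => ?_
      simp only [hb, norm_mul, norm_pow, Complex.norm_real, Real.norm_eq_abs, abs_of_pos hr]
      ring
    rw [h2]
    exact pow_le_pow_left₀ (mul_nonneg (normFrob_nonneg _) (pow_nonneg hr.le _))
      (mul_le_mul_of_nonneg_right (h _) (pow_nonneg hr.le _)) 2
  clear_value S
  -- Concavity is used through the tangent line at `S`: log t ≤ log S - 1 + t / S. The majorant is a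
  -- continuous sum of squares, so Parseval applies term by term.
  set G : ℂ → ℝ := fun z => (n : ℝ) / 2 * (Real.log S - 1) + ∑ i : Fin n, ∑ l : Fin n,
    (1 / (2 * S)) • ‖∑ j ∈ Finset.range (d + 1), z ^ j * b i l j‖ ^ 2 with hG
  have hGc : Continuous G := by fun_prop
  have hbound : ∀ z, q.eval z ≠ 0 → Real.log ‖q.eval z‖ ≤ G z := by
    intro z hz
    have h3 := norm_det_le_normFrob_pow (B z)
    rw [← hdet z] at h3
    have hpos := norm_pos_iff.2 hz
    have hF : 0 < normFrob (B z) := by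
      refine lt_of_le_of_ne (normFrob_nonneg _) fun h0 => ?_
      rw [← h0, zero_pow hn.ne'] at h3
      linarith
    have h4 := Real.log_le_log hpos h3
    rw [Real.log_pow] at h4
    have h5 := Real.log_le_sub_one_of_pos (div_pos (pow_pos hF 2) hS)
    rw [Real.log_div (pow_pos hF 2).ne' hS.ne', Real.log_pow, sq_normFrob] at h5
    have h6 : G z = (n : ℝ) / 2 * (Real.log S - 1) +
        (n : ℝ) / 2 * (1 / (n : ℝ) * (∑ i, ∑ l, ‖B z i l‖ ^ 2) / S) := by
      simp only [hG, hB, Matrix.of_apply, smul_eq_mul, ← Finset.mul_sum]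
      field_simp
    rw [h6]
    have h7 := mul_le_mul_of_nonneg_left h5 (show (0 : ℝ) ≤ (n : ℝ) / 2 by positivity)
    push_cast at h7
    linarith
  have havg : Real.circleAverage G 0 1 ≤ (n : ℝ) / 2 * Real.log S := by
    have hc : ∀ f : ℂ → ℝ, Continuous f → CircleIntegrable f 0 1 := fun f hf =>
      hf.continuousOn.circleIntegrable zero_le_one
    rw [hG, Real.circleAverage_fun_add (hc _ (by fun_prop)) (hc _ (by fun_prop)),
      Real.circleAverage_const, Real.circleAverage_fun_sum fun i _ => hc _ (by fun_prop)]
    have h8 : ∀ i : Fin n, Real.circleAverage (fun z => ∑ l : Fin n,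
        (1 / (2 * S)) • ‖∑ j ∈ Finset.range (d + 1), z ^ j * b i l j‖ ^ 2) 0 1 =
        1 / (2 * S) * ∑ l : Fin n, ∑ j ∈ Finset.range (d + 1), ‖b i l j‖ ^ 2 := by
      intro i
      rw [Real.circleAverage_fun_sum fun i _ => hc _ (by fun_prop), Finset.mul_sum]
      refine Finset.sum_congr rfl fun l _ => ?_
      rw [Real.circleAverage_fun_smul, circleAverage_sq_norm_sum, smul_eq_mul]
    simp only [h8, ← Finset.mul_sum]
    have h9 := mul_le_mul_of_nonneg_left hsum (show (0 : ℝ) ≤ (n : ℝ) / (2 * S) by positivity)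
    have h10 : (n : ℝ) / (2 * S) * S = (n : ℝ) / 2 := by field_simp
    have h11 : (n : ℝ) / (2 * S) *
        ((1 / (n : ℝ)) * ∑ i, ∑ l, ∑ j ∈ Finset.range (d + 1), ‖b i l j‖ ^ 2) =
        1 / (2 * S) * ∑ i, ∑ l, ∑ j ∈ Finset.range (d + 1), ‖b i l j‖ ^ 2 := by
      field_simp
    rw [h10, h11] at h9
    linarith
  have hfin := (logMahlerMeasure_le_circleAverage hq hGc hbound).trans havg
  rw [logMahlerMeasure_eq_log_MahlerMeasure] at hfin
  rw [← Real.log_le_log_iff (mahlerMeasure_pos_of_ne_zero hq) (Real.rpow_pos_of_pos hS _),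
    Real.log_rpow hS]
  exact hfin

end CircleAverages

/-! ### Two-sided bounds at a vertex. -/

section Vertices

/-- With truncated subtraction the exponent is |j - k|. The terms below `k` sum to at most δ/(1-δ),
the others to at most 1/(1-δ). -/
theorem sum_pow_dist_le {δ : ℝ} (h0 : 0 ≤ δ) (h1 : δ < 1) {k d : ℕ} (hk : k ≤ d) :
    ∑ j ∈ Finset.range (d + 1), δ ^ ((k - j) + (j - k)) ≤ (1 + δ) / (1 - δ) := by
  have hpos : 0 < 1 - δ := by linarith
  rw [← Finset.sum_range_add_sum_Ico _ (show k ≤ d + 1 by omega), Finset.sum_Ico_eq_sum_range,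
    ← Finset.sum_range_reflect]
  have e1 : ∑ j ∈ Finset.range k, δ ^ ((k - (k - 1 - j)) + ((k - 1 - j) - k)) =
      δ * ∑ j ∈ Finset.range k, δ ^ j := by
    rw [Finset.mul_sum]
    refine Finset.sum_congr rfl fun j hj => ?_
    have := Finset.mem_range.1 hj
    rw [← pow_succ']
    congr 1
    omega
  have e2 : ∑ j ∈ Finset.range (d + 1 - k), δ ^ ((k - (k + j)) + ((k + j) - k)) =
      ∑ j ∈ Finset.range (d + 1 - k), δ ^ j := by
    refine Finset.sum_congr rfl fun j _ => ?_
    congr 1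
    omega
  have h : ∀ m, ∑ j ∈ Finset.range m, δ ^ j ≤ 1 / (1 - δ) := by
    intro m
    rw [le_div_iff₀ hpos, mul_comm, mul_neg_geom_sum]
    linarith [pow_nonneg h0 m]
  rw [e1, e2, add_comm 1 δ, add_div, ← mul_one_div δ]
  exact add_le_add (mul_le_mul_of_nonneg_left (h k) h0) (h _)

/-- At the geometric mean of the two tropical roots around a vertex, the monomials decay
geometrically away from the vertex. -/
theorem IsTropicalRoots.sum_sq_le {d : ℕ} {a α : ℕ → ℝ} (hα : IsTropicalRoots d a α)
    (h0 : 0 < a 0) (hd : 0 < a d) (ha : ∀ i, 0 ≤ a i) {k : ℕ} (hk : k ∈ newtonVertices d a)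
    (hk1 : 1 ≤ k) (hkd : k < d) :
    ∑ j ∈ Finset.range (d + 1), (a j * √(α k * α (k + 1)) ^ j) ^ 2 ≤
      (a k * √(α k * α (k + 1)) ^ k) ^ 2 *
        ((1 + separation d α k) / (1 - separation d α k)) := by
  have hδ := hα.separation_mem_Ico h0 hd hk
  have hsep : separation d α k = α k / α (k + 1) := if_neg (by omega)
  have hβ : 0 < α (k + 1) := hα.root_pos h0 (by omega) (by omega)
  have hγ := hα.root_pos h0 hk1 hkd.le
  set r := √(α k * α (k + 1)) with hr
  have hr2 : r ^ 2 = α k * α (k + 1) := Real.sq_sqrt (by positivity)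
  have hr0 : 0 ≤ r := Real.sqrt_nonneg _
  set δ := separation d α k with hδdef
  -- Both `α k / r` and `r / α (k + 1)` equal √δ, so the squared terms lose a factor `δ` per step on
  -- either side of `k`.
  have hr2' : α k ^ 2 = r ^ 2 * δ := by rw [hr2, hsep]; field_simp
  have hr2'' : r ^ 2 = α (k + 1) ^ 2 * δ := by rw [hr2, hsep]; field_simp
  refine le_trans ?_ (mul_le_mul_of_nonneg_left (sum_pow_dist_le hδ.1 hδ.2 hkd.le) (sq_nonneg _))
  rw [Finset.mul_sum]
  refine Finset.sum_le_sum fun j hj => ?_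
  have hjd : j ≤ d := Nat.lt_succ_iff.1 (Finset.mem_range.1 hj)
  rcases le_total j k with h | h
  · have h1 := mul_le_mul_of_nonneg_right (hα.coeff_le_mul_pow h0 hd hk h) (pow_nonneg hr0 j)
    refine (pow_le_pow_left₀ (mul_nonneg (ha j) (pow_nonneg hr0 j)) h1 2).trans (le_of_eq ?_)
    obtain ⟨m, rfl⟩ := Nat.exists_eq_add_of_le h
    simp only [Nat.add_sub_cancel_left, Nat.sub_eq_zero_of_le h, add_zero]
    calc (a (j + m) * α (j + m) ^ m * r ^ j) ^ 2
        = a (j + m) ^ 2 * (α (j + m) ^ 2) ^ m * (r ^ j) ^ 2 := by ring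
      _ = (a (j + m) * r ^ (j + m)) ^ 2 * δ ^ m := by rw [hr2', mul_pow]; ring
  · have h1 := hα.coeff_mul_pow_le h0 hd hk h hjd
    have h2 := pow_le_pow_left₀ (mul_nonneg (ha j) (pow_nonneg hβ.le _)) h1 2
    obtain ⟨m, rfl⟩ := Nat.exists_eq_add_of_le h
    simp only [Nat.add_sub_cancel_left, Nat.sub_eq_zero_of_le h, zero_add] at h2 ⊢
    calc (a (k + m) * r ^ (k + m)) ^ 2
        = a (k + m) ^ 2 * (r ^ 2) ^ m * (r ^ k) ^ 2 := by ring
      _ = (a (k + m) * α (k + 1) ^ m) ^ 2 * ((r ^ k) ^ 2 * δ ^ m) := by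
          rw [hr2'', mul_pow]; ring
      _ ≤ a k ^ 2 * ((r ^ k) ^ 2 * δ ^ m) :=
          mul_le_mul_of_nonneg_right h2 (mul_nonneg (sq_nonneg _) (pow_nonneg hδ.1 m))
      _ = _ := by ring

variable {n d : ℕ} {A : ℕ → Matrix (Fin n) (Fin n) ℂ}
  {ν : Seminorm ℂ (Matrix (Fin n) (Fin n) ℂ)} {α : ℕ → ℝ}

/-- The coefficient of `detPoly` at a vertex is close to the determinant of the corresponding
matrix. -/
theorem norm_coeff_detPoly_sub_det_le_of_vertex (hν : DominatesFrob ν)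
    (hα : IsTropicalRoots d (fun i => ν (A i)) α) (h0 : 0 < ν (A 0)) (hd : 0 < ν (A d)) {k : ℕ}
    (hk : k ∈ newtonVertices d fun i => ν (A i)) :
    ‖(detPoly d A).coeff (n * k) - (A k).det‖ ≤ ((numMaps n d (n * k) : ℝ) - 1) *
      (∏ i, colConst ν i) * (ν (A k) ^ n * separation d α k) :=
  norm_coeff_detPoly_sub_det_le hν A (le_and_pos_of_mem_newtonVertices hk).1
    fun φ hφ hsum hne => hα.prod_coeff_le h0 hd (fun _ => apply_nonneg ν _) hk φ hφ hsum hne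

theorem mul_vertexConst_le_norm_coeff (hν : DominatesFrob ν)
    (hα : IsTropicalRoots d (fun i => ν (A i)) α) (h0 : 0 < ν (A 0)) (hd : 0 < ν (A d)) {k : ℕ}
    (hk : k ∈ newtonVertices d fun i => ν (A i)) :
    ν (A k) ^ n * vertexConst d ν A α k ≤ ‖(detPoly d A).coeff (n * k)‖ := by
  have h := norm_coeff_detPoly_sub_det_le_of_vertex hν hα h0 hd hk
  have hpos : 0 < ν (A k) ^ n := pow_pos (le_and_pos_of_mem_newtonVertices hk).2.1 n
  have h1 := norm_sub_norm_le (A k).det ((A k).det - (detPoly d A).coeff (n * k))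
  rw [sub_sub_cancel, norm_sub_rev] at h1
  have h2 : ν (A k) ^ n * (‖(A k).det‖ / ν (A k) ^ n) = ‖(A k).det‖ :=
    mul_div_cancel₀ _ hpos.ne'
  rw [vertexConst, mul_sub, h2]
  linarith

variable {N : ℕ} {ζ : ℕ → ℂ}

/-- The lower bound for the product of the largest eigenvalues. -/
theorem le_norm_leadingCoeff_mul_prod (hν : DominatesFrob ν)
    (hζ : IsEigenvalueSeq d A N ζ) (hα : IsTropicalRoots d (fun i => ν (A i)) α)
    (h0 : 0 < ν (A 0)) (hd : 0 < ν (A d)) (hp : (detPoly d A).coeff 0 ≠ 0) {k : ℕ}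
    (hk : k ∈ newtonVertices d fun i => ν (A i)) (hN : n * k ≤ N) :
    ν (A k) ^ n * vertexConst d ν A α k ≤ ((n * d).choose (n * k) : ℝ) *
      (‖(detPoly d A).leadingCoeff‖ * ∏ i ∈ Finset.Ioc (n * k) N, ‖ζ i‖) := by
  refine (mul_vertexConst_le_norm_coeff hν hα h0 hd hk).trans
    ((norm_coeff_le_choose_mul_prod hζ.roots hζ.mono hp hN).trans ?_)
  refine mul_le_mul_of_nonneg_right ?_ (by positivity)
  have := natDegree_detPoly_le d A
  rw [natDegree_eq_of_roots hζ.roots] at this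
  exact_mod_cast Nat.choose_le_choose _ this

/-- The upper bound for the product of the largest eigenvalues. -/
theorem norm_leadingCoeff_mul_prod_le (hn : 0 < n) (hν : DominatesFrob ν)
    (hζ : IsEigenvalueSeq d A N ζ) (hα : IsTropicalRoots d (fun i => ν (A i)) α)
    (h0 : 0 < ν (A 0)) (hd : 0 < ν (A d)) (hp : (detPoly d A).coeff 0 ≠ 0) {k : ℕ}
    (hk : k ∈ newtonVertices d fun i => ν (A i)) (hN : n * k ≤ N) :
    ‖(detPoly d A).leadingCoeff‖ * ∏ i ∈ Finset.Ioc (n * k) N, ‖ζ i‖ ≤ ν (A k) ^ n *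
      ((1 + separation d α k) / (1 - separation d α k)) ^ ((n : ℝ) / 2) := by
  obtain ⟨hkd, hak, -⟩ := le_and_pos_of_mem_newtonVertices hk
  have hp0 : detPoly d A ≠ 0 := fun h => hp (by rw [h, Polynomial.coeff_zero])
  have hdeg := natDegree_eq_of_roots hζ.roots
  -- At an end there is no pair of roots to average. There `δ = 0` makes the coefficient equal to
  -- det A_k, while L is its modulus: at `0` by Vieta, at `d` because the degree is then exactly `n
  -- * d`.
  by_cases hk' : k = 0 ∨ k = d
  · have hsep : separation d α k = 0 := if_pos hk'
    have hdet := norm_coeff_detPoly_sub_det_le_of_vertex hν hα h0 hd hk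
    rw [hsep, mul_zero, mul_zero, norm_le_zero_iff, sub_eq_zero] at hdet
    rw [hsep, add_zero, sub_zero, div_one, Real.one_rpow, mul_one]
    refine le_trans (le_of_eq ?_) (norm_det_le_pow hν (A k))
    rw [← hdet]
    rcases hk' with rfl | rfl
    · rw [mul_zero, norm_coeff_zero_eq_prod hζ.roots]
    · have hle := natDegree_detPoly_le k A
      obtain rfl : N = n * k := by omega
      rw [Finset.Ioc_self, Finset.prod_empty, mul_one, Polynomial.leadingCoeff, hdeg]
  · have hk1 : 1 ≤ k := by omega
    have hkd' : k < d := by omega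
    have hβ : 0 < α (k + 1) := hα.root_pos h0 (by omega) (by omega)
    have hγ := hα.root_pos h0 hk1 hkd
    have hδ := hα.separation_mem_Ico h0 hd hk
    have hr : 0 < √(α k * α (k + 1)) := Real.sqrt_pos.2 (mul_pos hγ hβ)
    have hS := hα.sum_sq_le h0 hd (fun _ => apply_nonneg ν _) hk hk1 hkd'
    set r := √(α k * α (k + 1)) with hrdef
    have hSpos : 0 < ∑ j ∈ Finset.range (d + 1), (ν (A j) * r ^ j) ^ 2 :=
      Finset.sum_pos' (fun _ _ => sq_nonneg _)
        ⟨k, Finset.mem_range.2 (by omega), pow_pos (mul_pos hak (pow_pos hr k)) 2⟩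
    have h1 := (pow_mul_prod_le_mahlerMeasure hζ.roots hr hN).trans
      (mahlerMeasure_detPoly_le hn hν hr hp0 hSpos)
    have h2 := Real.rpow_le_rpow hSpos.le hS (show (0 : ℝ) ≤ (n : ℝ) / 2 by positivity)
    have hratio : 0 ≤ (1 + separation d α k) / (1 - separation d α k) :=
      div_nonneg (by linarith [hδ.1]) (by linarith [hδ.2])
    have hbase : 0 ≤ ν (A k) * r ^ k := by positivity
    have h3 : ((ν (A k) * r ^ k) ^ 2) ^ ((n : ℝ) / 2) = ν (A k) ^ n * r ^ (n * k) := by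
      rw [← Real.rpow_natCast _ 2, ← Real.rpow_mul hbase, Nat.cast_ofNat,
        mul_div_cancel₀ _ two_ne_zero, Real.rpow_natCast, mul_pow, ← pow_mul, mul_comm k n]
    rw [Real.mul_rpow (sq_nonneg _) hratio, h3] at h2
    refine le_of_mul_le_mul_left ?_ (pow_pos hr (n * k))
    linarith

end Vertices

end TropEig

/-! ### Comparison of the bounds at consecutive vertices. -/

theorem corollary5p2 (n d : ℕ) (A : ℕ → Matrix (Fin n) (Fin n) ℂ)
    (hAd : A d ≠ 0) (hA0 : (A 0).det ≠ 0)
    -- a norm on the space of matrices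
    (ν : Seminorm ℂ (Matrix (Fin n) (Fin n) ℂ)) (hν : ∀ M, ν M = 0 → M = 0)
    (hν2 : TropEig.DominatesFrob ν)
    -- the eigenvalues, the tropical roots, and the abscissae of the Newton polygon vertices
    (N : ℕ) (ζ : ℕ → ℂ) (hζ : TropEig.IsEigenvalueSeq d A N ζ)
    (α : ℕ → ℝ) (hα : TropEig.IsTropicalRoots d (fun i => ν (A i)) α)
    (q : ℕ) (k : ℕ → ℕ) (hk : StrictMonoOn k (Set.Iic q))
    (hkv : k '' Set.Iic q = TropEig.newtonVertices d (fun i => ν (A i)))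
    (δ : ℕ → ℝ) (hδ : ∀ i, δ i = TropEig.separation d α (k i))
    (c : ℕ → ℝ) (hc : ∀ i, c i = TropEig.vertexConst d ν A α (k i))
    (j : ℕ) (hj1 : 1 ≤ j) (hjq : j ≤ q) (hcj : 0 < c j) (hcj' : 0 < c (j - 1)) :
    -- the eigenvalues in question are finite
    n * k j ≤ N ∧
    c (j - 1) / ((n * d).choose (n * k (j - 1)) : ℝ)
        * ((1 - δ j) / (1 + δ j)) ^ ((n : ℝ) / 2)
      ≤ ‖∏ i ∈ Finset.Icc (n * k (j - 1) + 1) (n * k j), ζ i‖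
          / α (k j) ^ (n * (k j - k (j - 1))) ∧
    ‖∏ i ∈ Finset.Icc (n * k (j - 1) + 1) (n * k j), ζ i‖
          / α (k j) ^ (n * (k j - k (j - 1)))
      ≤ ((n * d).choose (n * k j) : ℝ) / c j
        * ((1 + δ (j - 1)) / (1 - δ (j - 1))) ^ ((n : ℝ) / 2) := by
  have hn : 0 < n := by
    rcases Nat.eq_zero_or_pos n with rfl | h
    · exact absurd (Subsingleton.elim _ _) hAd
    · exact h
  have hpos : ∀ M, M ≠ 0 → 0 < ν M := fun M hM =>
    lt_of_le_of_ne (apply_nonneg ν M) fun h => hM (hν M h.symm)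
  have h0 : 0 < ν (A 0) := by
    refine hpos _ fun h => hA0 ?_
    have : Nonempty (Fin n) := ⟨⟨0, hn⟩⟩
    rw [h, Matrix.det_zero]
  have hd := hpos _ hAd
  have hp : (TropEig.detPoly d A).coeff 0 ≠ 0 := by
    rw [Polynomial.coeff_zero_eq_eval_zero, TropEig.eval_detPoly, Finset.sum_eq_single 0
      (fun i _ hi => by simp [hi]) (by simp)]
    simpa using hA0
  have hv : ∀ i ≤ q, k i ∈ TropEig.newtonVertices d fun i => ν (A i) := fun i hi =>
    hkv ▸ Set.mem_image_of_mem k hi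
  have hvj := hv j hjq
  have hvj' := hv (j - 1) (by omega)
  have hlt : k (j - 1) < k j := hk (Set.mem_Iic.2 (by omega)) hjq (by omega)
  have hcons : ∀ l, k (j - 1) < l → l < k j → l ∉ TropEig.newtonVertices d fun i => ν (A i) := by
    intro l hl1 hl2 hl
    rw [← hkv] at hl
    obtain ⟨i, hi, rfl⟩ := hl
    have h1 := (hk.lt_iff_lt (Set.mem_Iic.2 (by omega)) hi).1 hl1
    have h2 := (hk.lt_iff_lt hi hjq).1 hl2
    omega
  have hratio := hα.coeff_eq_mul_pow_of_consecutive h0 hd hvj' hvj hlt hcons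
  obtain ⟨hkd, haj, -⟩ := TropEig.le_and_pos_of_mem_newtonVertices hvj
  obtain ⟨hkd', haj', -⟩ := TropEig.le_and_pos_of_mem_newtonVertices hvj'
  have hδj := hα.separation_mem_Ico h0 hd hvj
  have hδj' := hα.separation_mem_Ico h0 hd hvj'
  have hαj := hα.root_pos h0 (l := k j) (by omega) hkd
  -- Positivity of `c j` makes the coefficient of index `n * k j` nonzero, which bounds the degree
  -- `N` from below.
  have hN : n * k j ≤ N := by
    rw [← TropEig.natDegree_eq_of_roots hζ.roots]
    refine Polynomial.le_natDegree_of_ne_zero fun h => ?_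
    have h1 := TropEig.mul_vertexConst_le_norm_coeff hν2 hα h0 hd hvj
    rw [h, norm_zero, ← hc] at h1
    exact absurd (mul_pos (pow_pos haj n) hcj) (not_lt.2 h1)
  have hN' : n * k (j - 1) ≤ N := (Nat.mul_le_mul_left n hlt.le).trans hN
  have hU := TropEig.norm_leadingCoeff_mul_prod_le hn hν2 hζ hα h0 hd hp hvj hN
  have hU' := TropEig.norm_leadingCoeff_mul_prod_le hn hν2 hζ hα h0 hd hp hvj' hN'
  have hL := TropEig.le_norm_leadingCoeff_mul_prod hν2 hζ hα h0 hd hp hvj hN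
  have hL' := TropEig.le_norm_leadingCoeff_mul_prod hν2 hζ hα h0 hd hp hvj' hN'
  rw [← hδ] at hU hU' hδj hδj'
  rw [← hc] at hL hL'
  have hsplit := Finset.prod_Ioc_consecutive (fun i => ‖ζ i‖) (Nat.mul_le_mul_left n hlt.le) hN
  set P := ‖∏ i ∈ Finset.Icc (n * k (j - 1) + 1) (n * k j), ζ i‖ with hP
  have hPeq : ∏ i ∈ Finset.Ioc (n * k (j - 1)) (n * k j), ‖ζ i‖ = P := by
    rw [hP, norm_prod]
    refine Finset.prod_congr (Finset.ext fun i => ?_) fun _ _ => rfl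
    simp only [Finset.mem_Ioc, Finset.mem_Icc, Nat.succ_le_iff]
  rw [hPeq] at hsplit
  rw [← hsplit] at hU' hL'
  have hpow : ν (A (k (j - 1))) ^ n = ν (A (k j)) ^ n * α (k j) ^ (n * (k j - k (j - 1))) := by
    rw [hratio, mul_pow, ← pow_mul, mul_comm n]
  rw [hpow] at hU' hL'
  set T := ∏ i ∈ Finset.Ioc (n * k j) N, ‖ζ i‖ with hT
  set ℓ := ‖(TropEig.detPoly d A).leadingCoeff‖ with hℓ
  set a := ν (A (k j)) ^ n with ha
  set b := α (k j) ^ (n * (k j - k (j - 1))) with hb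
  have ha0 : 0 < a := pow_pos haj n
  have hb0 : 0 < b := pow_pos hαj _
  have hC : (0 : ℝ) < (n * d).choose (n * k j) := by
    exact_mod_cast Nat.choose_pos (Nat.mul_le_mul_left n hkd)
  have hC' : (0 : ℝ) < (n * d).choose (n * k (j - 1)) := by
    exact_mod_cast Nat.choose_pos (Nat.mul_le_mul_left n hkd')
  have hP0 : 0 ≤ P := norm_nonneg _
  refine ⟨hN, ?_, ?_⟩
  · set w := ((1 + δ j) / (1 - δ j)) ^ ((n : ℝ) / 2) with hw
    have hwpos : 0 < w :=
      Real.rpow_pos_of_pos (div_pos (by linarith [hδj.1]) (by linarith [hδj.2])) _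
    have hinv : ((1 - δ j) / (1 + δ j)) ^ ((n : ℝ) / 2) = w⁻¹ := by
      rw [hw, ← Real.inv_rpow (div_nonneg (by linarith [hδj.1]) (by linarith [hδj.2])), inv_div]
    rw [hinv, ← div_eq_mul_inv, div_div, div_le_div_iff₀ (mul_pos hC' hwpos) hb0]
    refine le_of_mul_le_mul_left ?_ ha0
    -- Lower bound at `k (j - 1)` against upper bound at `k j`; the other inequality exchanges these
    -- roles.
    have h1 := mul_le_mul_of_nonneg_left hU (mul_nonneg hC'.le hP0)
    linarith
  · set w := ((1 + δ (j - 1)) / (1 - δ (j - 1))) ^ ((n : ℝ) / 2) with hw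
    rw [div_mul_eq_mul_div, div_le_div_iff₀ hb0 hcj]
    refine le_of_mul_le_mul_left ?_ ha0
    have h1 := mul_le_mul_of_nonneg_left hL hP0
    have h2 := mul_le_mul_of_nonneg_left hU' hC.le
    linarith
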